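/- For $|q|<1$, $a\in\mathbb{C}$ and $n\in\mathbb{N}_0\cup\{\infty\}$ write $(a;q)_n:=\prod_{j=0}^{n-1}(1-aq^j)$. Let $g(n)$, $n\ge 0$, be the restricted colored partition function of Andrews and Kumar, that is, the coefficients in the expansion $$\sum_{n\ge 0} g(n)q^n:=\sum_{n\ge 0}\frac{q^{2n+1}}{(q^{2n+1};q)_\infty\,(q^{2n+2};q^2)_n}.$$ Then, as $n\to\infty$, $$g(n)\sim\frac{e^{\pi\sqrt{\frac{2n}{3}}}}{4\sqrt{3}\,n}.$$ -/

import Mathlib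

open Filter Asymptotics
open scoped PowerSeries PowerSeries.WithPiTopology

noncomputable section

/-- The finite `q`-Pochhammer symbol `(a; q)_n = ∏_{j=0}^{n-1} (1 - a q^j)`. -/
def qPochhammer {R : Type*} [CommRing R] (a q : R) (n : ℕ) : R :=
  ∏ j ∈ Finset.range n, (1 - a * q ^ j)

/-- The infinite `q`-Pochhammer symbol `(a; q)_∞ = ∏_{j=0}^∞ (1 - a q^j)`. -/
def qPochhammerInf {R : Type*} [CommRing R] [TopologicalSpace R] (a q : R) : R :=
  ∏' j : ℕ, (1 - a * q ^ j)

/-- The `n`-th summand `q^(2n+1) / ((q^(2n+1); q)_∞ (q^(2n+2); q^2)_n)`, as a formal power series in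
the variable `q = X`. The denominator has constant coefficient `1`, so that `⁻¹` is the
multiplicative inverse of power series. -/
def akTerm (n : ℕ) : ℝ⟦X⟧ :=
  PowerSeries.X ^ (2 * n + 1) *
    (qPochhammerInf (PowerSeries.X ^ (2 * n + 1)) PowerSeries.X *
      qPochhammer (PowerSeries.X ^ (2 * n + 2)) (PowerSeries.X ^ 2) n)⁻¹

/-- The generating function `∑_{n ≥ 0} q^(2n+1) / ((q^(2n+1); q)_∞ (q^(2n+2); q^2)_n)` of the
restricted coloured partitions of Andrews and Kumar, as a formal power series in `q = X`; sums and
products converge in the topology of coefficientwise convergence. -/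
def akSeries : ℝ⟦X⟧ := ∑' n : ℕ, akTerm n

/-- `g(n)`, the coefficient of `q^n` in the generating function. -/
def akG (n : ℕ) : ℝ := PowerSeries.coeff n akSeries


/-- The infinite product in each denominator converges. -/
theorem multipliable_akFactor (n : ℕ) :
    Multipliable fun j : ℕ => (1 - PowerSeries.X ^ (2 * n + 1) * PowerSeries.X ^ j : ℝ⟦X⟧) := by
  simp_rw [sub_eq_add_neg]
  apply PowerSeries.WithPiTopology.multipliable_one_add_of_tendsto_order_atTop_nhds_top
  rw [ENat.tendsto_nhds_top_iff_natCast_lt]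
  intro m
  filter_upwards [eventually_gt_atTop m] with j hj
  rw [PowerSeries.order_neg, ← pow_add, PowerSeries.order_X_pow]
  exact_mod_cast (by omega : m < 2 * n + 1 + j)

/-- Each denominator is an invertible power series. -/
theorem constantCoeff_akDenom (n : ℕ) :
    PowerSeries.constantCoeff (qPochhammerInf (PowerSeries.X ^ (2 * n + 1)) PowerSeries.X *
      qPochhammer (PowerSeries.X ^ (2 * n + 2)) (PowerSeries.X ^ 2) n : ℝ⟦X⟧) = 1 := by
  have h : PowerSeries.constantCoeff
      (qPochhammerInf (PowerSeries.X ^ (2 * n + 1)) PowerSeries.X : ℝ⟦X⟧) = 1 := by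
    rw [qPochhammerInf, (multipliable_akFactor n).map_tprod _
      (PowerSeries.WithPiTopology.continuous_constantCoeff ℝ)]
    simp
  rw [map_mul, h, qPochhammer, map_prod]
  simp

/-- The series defining the generating function converges. -/
theorem summable_akTerm : Summable akTerm := by
  apply PowerSeries.WithPiTopology.summable_of_tendsto_order_atTop_nhds_top
  rw [ENat.tendsto_nhds_top_iff_natCast_lt]
  intro m
  filter_upwards [eventually_gt_atTop m] with n hn
  have h : ((2 * n + 1 : ℕ) : ℕ∞) ≤ (akTerm n).order := by
    rw [akTerm]
    refine le_trans ?_ (PowerSeries.le_order_mul _ _)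
    rw [PowerSeries.order_X_pow]
    exact le_self_add
  refine lt_of_lt_of_le ?_ h
  exact_mod_cast (by omega : m < 2 * n + 1)

end

/-! Write `p(n)` for the number of partitions of `n`, the coefficients of `1 / (q; q)_∞`. The proof
compares `g` with `p` and then establishes the Hardy–Ramanujan formula for `p`.

*Comparison.* The summand `n = 0` is `q / (q; q)_∞`, so it contributes `p(N)` to `g(N + 1)`. From
`1 - q^(2k) = (1 - q^k) (1 + q^k)` the `n`-th summand is coefficientwise at most
`q^(2n+1) / (q^(n+1); q)_∞`, and `q` times this is at most
`q^(n+1) / (q^(n+1); q)_∞ = 1 / (q^(n+1); q)_∞ - 1 / (q^(n+2); q)_∞` (`coeff_akTerm_le_sub`).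
These bounds telescope: the summands with `n ≥ 1` contribute together at most the number
`p(N + 2) - p(N + 1)` of partitions of `N + 2` without the part `1`. Hence
`p(N) ≤ g(N + 1) ≤ p(N) + p(N + 2) - p(N + 1)` (`partitionCount_le_akG_succ`, `akG_succ_le`), and
the error is `o(p(N))` as soon as the asymptotics of `p` is known.

*Asymptotics of `p`.* Cauchy's formula on the circle of radius `e^(-x)`, `x = π / √(6n)`, expresses
`p(n)` as an integral over `q = e^(-x + iy)` (`integral_circle_eq_partitionCount`). In the variable
`v = x^(-3/2) y` the integrand, divided by the real scale `√(x / 2π) e^(π² / 6x)`, converges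
pointwise to the Gaussian `e^(-π² v² / 6)`; this is the transformation of Dedekind's eta function
under `τ ↦ -1 / τ` (`inv_eulerProd_exp_neg`, `tendsto_inv_eulerProd_scaled`). It has an integrable
majorant over the whole circle, because every factor of `(q; q)_∞` satisfies
`|1 - w|² ≥ (1 - |w|)² exp ((|w| - Re w) / 2)` and the exponents sum to a geometric series
(`norm_inv_eulerProd_le`, `exp_neg_gap_le_arcMajorant`). So dominated convergence gives the limit of
the integral, with no division into major and minor arcs. -/

/-! ### Partitions with a lower bound on the parts, and the comparison of `g` with `p` -/

theorem multipliable_one_sub_X_pow_mul (s : ℕ) :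
    Multipliable fun j : ℕ => (1 - PowerSeries.X ^ s * PowerSeries.X ^ j : ℝ⟦X⟧) := by
  simp_rw [sub_eq_add_neg]
  apply PowerSeries.WithPiTopology.multipliable_one_add_of_tendsto_order_atTop_nhds_top
  rw [ENat.tendsto_nhds_top_iff_natCast_lt]
  intro m
  filter_upwards [eventually_gt_atTop m] with j hj
  rw [PowerSeries.order_neg, ← pow_add, PowerSeries.order_X_pow]
  exact_mod_cast (by omega : m < s + j)

/-- The congruence `(q^s; q)_∞ ≡ 1` modulo `q^s` passes from the finite products to the limit,
since each coefficient is continuous. -/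
theorem X_pow_dvd_qPochhammerInf_sub_one (s : ℕ) :
    (PowerSeries.X ^ s : ℝ⟦X⟧) ∣ qPochhammerInf (PowerSeries.X ^ s) PowerSeries.X - 1 := by
  have hfin (t : Finset ℕ) : (PowerSeries.X ^ s : ℝ⟦X⟧) ∣
      ∏ j ∈ t, (1 - PowerSeries.X ^ s * PowerSeries.X ^ j) - 1 := by
    induction t using Finset.induction_on with
    | empty => simp
    | insert a t ha ih =>
      rw [Finset.prod_insert ha, sub_mul, one_mul, sub_right_comm, mul_assoc]
      exact dvd_sub ih (dvd_mul_right _ _)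
  rw [PowerSeries.X_pow_dvd_iff]
  intro m hm
  have hlim := ((PowerSeries.WithPiTopology.continuous_coeff ℝ m).tendsto _).comp
    ((multipliable_one_sub_X_pow_mul s).hasProd)
  have hconst : (fun t : Finset ℕ => PowerSeries.coeff m
      (∏ j ∈ t, (1 - PowerSeries.X ^ s * PowerSeries.X ^ j : ℝ⟦X⟧))) =
      fun _ => PowerSeries.coeff m (1 : ℝ⟦X⟧) := by
    funext t
    have := PowerSeries.X_pow_dvd_iff.mp (hfin t) m hm
    rwa [map_sub, sub_eq_zero] at this
  rw [map_sub, sub_eq_zero]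
  refine tendsto_nhds_unique hlim ?_
  rw [SummationFilter.unconditional_filter]
  change Tendsto (fun t : Finset ℕ => PowerSeries.coeff m
      (∏ j ∈ t, (1 - PowerSeries.X ^ s * PowerSeries.X ^ j : ℝ⟦X⟧))) _ _
  rw [hconst]
  exact tendsto_const_nhds

theorem constantCoeff_qPochhammerInf_X_pow {s : ℕ} (hs : 1 ≤ s) :
    PowerSeries.constantCoeff (qPochhammerInf (PowerSeries.X ^ s) PowerSeries.X : ℝ⟦X⟧) = 1 := by
  have := PowerSeries.X_pow_dvd_iff.mp (X_pow_dvd_qPochhammerInf_sub_one s) 0 (by omega)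
  rw [map_sub, sub_eq_zero] at this
  simpa using this

theorem qPochhammerInf_X_pow_eq_mul (s : ℕ) :
    (qPochhammerInf (PowerSeries.X ^ s) PowerSeries.X : ℝ⟦X⟧) =
      (1 - PowerSeries.X ^ s) * qPochhammerInf (PowerSeries.X ^ (s + 1)) PowerSeries.X := by
  have hf : (fun j : ℕ => (1 - PowerSeries.X ^ s * PowerSeries.X ^ (j + 1) : ℝ⟦X⟧)) =
      fun j : ℕ => 1 - PowerSeries.X ^ (s + 1) * PowerSeries.X ^ j := by
    funext j
    rw [← pow_add, ← pow_add, add_right_comm, add_assoc]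
  have h := tprod_eq_zero_mul' (f := fun j : ℕ =>
    (1 - PowerSeries.X ^ s * PowerSeries.X ^ j : ℝ⟦X⟧))
    (by rw [hf]; exact multipliable_one_sub_X_pow_mul (s + 1))
  rw [hf] at h
  simpa only [qPochhammerInf, pow_zero, mul_one] using h

/-- The generating function `1 / (q^s; q)_∞` of the partitions all of whose parts are at least `s`.
For `s = 0` the denominator vanishes and the series is zero. -/
noncomputable def partsAtLeast (s : ℕ) : ℝ⟦X⟧ :=
  (qPochhammerInf (PowerSeries.X ^ s) PowerSeries.X)⁻¹

theorem qPochhammerInf_mul_partsAtLeast {s : ℕ} (hs : 1 ≤ s) :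
    qPochhammerInf (PowerSeries.X ^ s) PowerSeries.X * partsAtLeast s = 1 :=
  PowerSeries.mul_inv_cancel _ (by simp [constantCoeff_qPochhammerInf_X_pow hs])

theorem one_sub_X_pow_mul_partsAtLeast {s : ℕ} (hs : 1 ≤ s) :
    (1 - PowerSeries.X ^ s) * partsAtLeast s = partsAtLeast (s + 1) := by
  have h1 := qPochhammerInf_mul_partsAtLeast hs
  have h2 := qPochhammerInf_mul_partsAtLeast (Nat.le_add_left 1 s)
  rw [qPochhammerInf_X_pow_eq_mul] at h1
  linear_combination (partsAtLeast (s + 1)) * h1 - (1 - PowerSeries.X ^ s) * partsAtLeast s * h2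

theorem coeff_partsAtLeast_of_lt {s n : ℕ} (hn : n < s) :
    PowerSeries.coeff n (partsAtLeast s) = if n = 0 then 1 else 0 := by
  have h1 := qPochhammerInf_mul_partsAtLeast (by omega : 1 ≤ s)
  have hd : (PowerSeries.X ^ s : ℝ⟦X⟧) ∣ partsAtLeast s - 1 := by
    have := (X_pow_dvd_qPochhammerInf_sub_one s).mul_right (- partsAtLeast s)
    convert this using 1
    linear_combination h1
  have := PowerSeries.X_pow_dvd_iff.mp hd n hn
  rwa [map_sub, sub_eq_zero, PowerSeries.coeff_one] at this

/-- Splitting the partitions with all parts at least `s` according to whether `s` is a part. -/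
theorem coeff_partsAtLeast {s : ℕ} (hs : 1 ≤ s) (n : ℕ) :
    PowerSeries.coeff n (partsAtLeast s) = PowerSeries.coeff n (partsAtLeast (s + 1)) +
      if s ≤ n then PowerSeries.coeff (n - s) (partsAtLeast s) else 0 := by
  rw [← one_sub_X_pow_mul_partsAtLeast hs, sub_mul, one_mul, map_sub,
    PowerSeries.coeff_X_pow_mul']
  ring

theorem coeff_partsAtLeast_nonneg {s : ℕ} (hs : 1 ≤ s) (n : ℕ) :
    0 ≤ PowerSeries.coeff n (partsAtLeast s) := by
  induction n using Nat.strong_induction_on generalizing s with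
  | _ n ihn =>
    -- Descending induction on `s`: for `s > n` the coefficient is that of `1`, and passing from
    -- `s + 1` to `s` adds a coefficient of smaller index.
    have key (k : ℕ) : ∀ s : ℕ, 1 ≤ s → n < s + k →
        0 ≤ PowerSeries.coeff n (partsAtLeast s) := by
      induction k with
      | zero =>
        intro s _ hlt
        rw [coeff_partsAtLeast_of_lt (by simpa using hlt)]
        split_ifs <;> norm_num
      | succ k ihk =>
        intro s hs hlt
        rw [coeff_partsAtLeast hs]
        refine add_nonneg (ihk (s + 1) (by omega) (by omega)) ?_
        split_ifs with h
        · exact ihn (n - s) (by omega) hs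
        · exact le_rfl
    exact key (n + 1) s hs (by omega)

theorem coeff_partsAtLeast_succ_le {s : ℕ} (hs : 1 ≤ s) (n : ℕ) :
    PowerSeries.coeff n (partsAtLeast (s + 1)) ≤ PowerSeries.coeff n (partsAtLeast s) := by
  rw [coeff_partsAtLeast hs]
  split_ifs
  · exact le_add_of_nonneg_right (coeff_partsAtLeast_nonneg hs _)
  · simp

theorem coeff_mul_nonneg {A B : ℝ⟦X⟧} (hA : ∀ n, 0 ≤ PowerSeries.coeff n A)
    (hB : ∀ n, 0 ≤ PowerSeries.coeff n B) (n : ℕ) : 0 ≤ PowerSeries.coeff n (A * B) := by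
  rw [PowerSeries.coeff_mul]
  exact Finset.sum_nonneg fun i _ => mul_nonneg (hA _) (hB _)

theorem coeff_prod_one_add_X_pow_sub_one_nonneg (e : ℕ → ℕ) (m n : ℕ) :
    0 ≤ PowerSeries.coeff n (∏ j ∈ Finset.range m, (1 + PowerSeries.X ^ e j) - 1 : ℝ⟦X⟧) := by
  induction m generalizing n with
  | zero => simp
  | succ m ih =>
    have : (∏ j ∈ Finset.range (m + 1), (1 + PowerSeries.X ^ e j) - 1 : ℝ⟦X⟧) =
        (∏ j ∈ Finset.range m, (1 + PowerSeries.X ^ e j) - 1) +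
          PowerSeries.X ^ e m * (∏ j ∈ Finset.range m, (1 + PowerSeries.X ^ e j) - 1) +
          PowerSeries.X ^ e m := by
      rw [Finset.prod_range_succ]; ring
    rw [this, map_add, map_add, PowerSeries.coeff_X_pow_mul', PowerSeries.coeff_X_pow]
    refine add_nonneg (add_nonneg (ih n) ?_) ?_
    · split_ifs
      exacts [ih _, le_rfl]
    · split_ifs <;> norm_num

theorem partsAtLeast_eq_prod_mul {s : ℕ} (hs : 1 ≤ s) (m : ℕ) :
    (∏ j ∈ Finset.range m, (1 - PowerSeries.X ^ (s + j))) * partsAtLeast s =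
      partsAtLeast (s + m) := by
  induction m with
  | zero => simp
  | succ m ih =>
    rw [Finset.prod_range_succ, mul_right_comm, ih, mul_comm,
      one_sub_X_pow_mul_partsAtLeast (by omega), add_assoc]

theorem akTerm_mul_denom (n : ℕ) :
    akTerm n * (qPochhammerInf (PowerSeries.X ^ (2 * n + 1)) PowerSeries.X *
      qPochhammer (PowerSeries.X ^ (2 * n + 2)) (PowerSeries.X ^ 2) n) =
      PowerSeries.X ^ (2 * n + 1) := by
  rw [akTerm, mul_assoc, PowerSeries.inv_mul_cancel _ (by simp [constantCoeff_akDenom]), mul_one]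

/-- Since `1 - q^(2k) = (1 - q^k) (1 + q^k)`, the `n`-th summand becomes
`q^(2n+1) / (q^(n+1); q)_∞` once it is multiplied by the factors `1 + q^k`, `n < k ≤ 2n`. -/
theorem akTerm_mul_prod (n : ℕ) :
    akTerm n * ∏ j ∈ Finset.range n, (1 + PowerSeries.X ^ (n + 1 + j)) =
      PowerSeries.X ^ (2 * n + 1) * partsAtLeast (n + 1) := by
  have h1 := akTerm_mul_denom n
  have h2 := qPochhammerInf_mul_partsAtLeast (by omega : 1 ≤ 2 * n + 1)
  have h3 := partsAtLeast_eq_prod_mul (by omega : 1 ≤ n + 1) n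
  rw [show n + 1 + n = 2 * n + 1 by ring] at h3
  have h4 : (qPochhammer (PowerSeries.X ^ (2 * n + 2)) (PowerSeries.X ^ 2) n : ℝ⟦X⟧) =
      (∏ j ∈ Finset.range n, (1 - PowerSeries.X ^ (n + 1 + j))) *
        ∏ j ∈ Finset.range n, (1 + PowerSeries.X ^ (n + 1 + j)) := by
    rw [qPochhammer, ← Finset.prod_mul_distrib]
    exact Finset.prod_congr rfl fun j _ => by ring
  rw [h4] at h1
  set A := ∏ j ∈ Finset.range n, (1 - PowerSeries.X ^ (n + 1 + j) : ℝ⟦X⟧)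
  set B := ∏ j ∈ Finset.range n, (1 + PowerSeries.X ^ (n + 1 + j) : ℝ⟦X⟧)
  rw [← h3] at h2
  linear_combination partsAtLeast (n + 1) * h1 - akTerm n * B * h2

theorem coeff_nonneg_of_one_sub_X_pow_mul {k : ℕ} (hk : 1 ≤ k) {A : ℝ⟦X⟧}
    (h : ∀ n, 0 ≤ PowerSeries.coeff n ((1 - PowerSeries.X ^ k) * A)) (n : ℕ) :
    0 ≤ PowerSeries.coeff n A := by
  induction n using Nat.strong_induction_on with
  | _ n ih =>
    have := h n
    rw [sub_mul, one_mul, map_sub, PowerSeries.coeff_X_pow_mul'] at this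
    split_ifs at this with hkn
    · linarith [ih (n - k) (by omega)]
    · linarith

theorem coeff_nonneg_of_prod_one_sub_X_pow_mul {e : ℕ → ℕ} (he : ∀ j, 1 ≤ e j) {A : ℝ⟦X⟧} (m : ℕ)
    (h : ∀ n, 0 ≤ PowerSeries.coeff n ((∏ j ∈ Finset.range m, (1 - PowerSeries.X ^ e j)) * A))
    (n : ℕ) : 0 ≤ PowerSeries.coeff n A := by
  induction m with
  | zero => simpa using h n
  | succ m ih =>
    refine ih (coeff_nonneg_of_one_sub_X_pow_mul (he m) fun n => ?_)
    rw [← mul_assoc, mul_comm (1 - _), ← Finset.prod_range_succ]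
    exact h n

theorem coeff_X_pow_mul_nonneg {A : ℝ⟦X⟧} (hA : ∀ n, 0 ≤ PowerSeries.coeff n A) (k n : ℕ) :
    0 ≤ PowerSeries.coeff n (PowerSeries.X ^ k * A) := by
  rw [PowerSeries.coeff_X_pow_mul']
  split_ifs
  exacts [hA _, le_rfl]

theorem coeff_akTerm_nonneg (n N : ℕ) : 0 ≤ PowerSeries.coeff N (akTerm n) := by
  refine coeff_nonneg_of_prod_one_sub_X_pow_mul (e := fun j => 2 * n + 2 + 2 * j)
    (fun j => by omega) n (fun N => ?_) N
  have h1 := akTerm_mul_denom n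
  have h2 := qPochhammerInf_mul_partsAtLeast (by omega : 1 ≤ 2 * n + 1)
  have h3 : (∏ j ∈ Finset.range n, (1 - PowerSeries.X ^ (2 * n + 2 + 2 * j))) * akTerm n =
      PowerSeries.X ^ (2 * n + 1) * partsAtLeast (2 * n + 1) := by
    have : (∏ j ∈ Finset.range n, (1 - PowerSeries.X ^ (2 * n + 2 + 2 * j)) : ℝ⟦X⟧) =
        qPochhammer (PowerSeries.X ^ (2 * n + 2)) (PowerSeries.X ^ 2) n :=
      Finset.prod_congr rfl fun j _ => by ring
    rw [this]
    linear_combination partsAtLeast (2 * n + 1) * h1 - akTerm n *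
      qPochhammer (PowerSeries.X ^ (2 * n + 2)) (PowerSeries.X ^ 2) n * h2
  rw [h3]
  exact coeff_X_pow_mul_nonneg (coeff_partsAtLeast_nonneg (by omega)) _ _

/-- Coefficientwise, `q` times the `n`-th summand is at most
`q^(n+1) / (q^(n+1); q)_∞ = 1 / (q^(n+1); q)_∞ - 1 / (q^(n+2); q)_∞`. -/
theorem coeff_akTerm_le_sub (n N : ℕ) : PowerSeries.coeff N (akTerm n) ≤
    PowerSeries.coeff (N + 1) (partsAtLeast (n + 1)) -
      PowerSeries.coeff (N + 1) (partsAtLeast (n + 2)) := by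
  have h1 : 0 ≤ PowerSeries.coeff N
      (PowerSeries.X ^ (2 * n + 1) * partsAtLeast (n + 1) - akTerm n) := by
    rw [← akTerm_mul_prod, ← mul_sub_one]
    exact coeff_mul_nonneg (coeff_akTerm_nonneg n)
      (coeff_prod_one_add_X_pow_sub_one_nonneg _ _) N
  have h2 : 0 ≤ PowerSeries.coeff (N + 1)
      (PowerSeries.X ^ (n + 1) * partsAtLeast (n + 2)) :=
    coeff_X_pow_mul_nonneg (coeff_partsAtLeast_nonneg (by omega)) _ _
  have h3 : partsAtLeast (n + 1) - partsAtLeast (n + 2) -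
      PowerSeries.X * (PowerSeries.X ^ (2 * n + 1) * partsAtLeast (n + 1)) =
      PowerSeries.X ^ (n + 1) * partsAtLeast (n + 2) := by
    rw [← one_sub_X_pow_mul_partsAtLeast (by omega : 1 ≤ n + 1)]
    ring
  rw [← h3, map_sub, map_sub, PowerSeries.coeff_succ_X_mul] at h2
  rw [map_sub] at h1
  linarith

/-- The number of partitions of `n`, as a real number. -/
noncomputable def partitionCount (n : ℕ) : ℝ := PowerSeries.coeff n (partsAtLeast 1)

theorem partitionCount_nonneg (n : ℕ) : 0 ≤ partitionCount n := coeff_partsAtLeast_nonneg le_rfl n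

theorem akTerm_zero : akTerm 0 = PowerSeries.X * partsAtLeast 1 := by
  simpa using akTerm_mul_prod 0

theorem hasSum_coeff_akTerm (N : ℕ) :
    HasSum (fun n => PowerSeries.coeff N (akTerm n)) (akG N) :=
  summable_akTerm.hasSum.map (PowerSeries.coeff N : ℝ⟦X⟧ →ₗ[ℝ] ℝ)
    (PowerSeries.WithPiTopology.continuous_coeff ℝ N)

theorem partitionCount_le_akG_succ (N : ℕ) : partitionCount N ≤ akG (N + 1) := by
  have h := (hasSum_coeff_akTerm (N + 1)).summable.le_tsum 0
    (fun j _ => coeff_akTerm_nonneg j (N + 1))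
  rwa [(hasSum_coeff_akTerm (N + 1)).tsum_eq, akTerm_zero, PowerSeries.coeff_succ_X_mul] at h

/-- The summands after the zeroth contribute together at most the number of partitions of `N + 2`
without the part `1`: their upper bounds telescope. -/
theorem akG_succ_le (N : ℕ) : akG (N + 1) ≤
    partitionCount N + (partitionCount (N + 2) - partitionCount (N + 1)) := by
  refine le_of_tendsto (hasSum_coeff_akTerm (N + 1)).tendsto_sum_nat
    ((eventually_ge_atTop 1).mono fun M hM => ?_)
  obtain ⟨M, rfl⟩ := Nat.exists_eq_add_of_le' hM
  have hle : ∑ n ∈ Finset.range M, PowerSeries.coeff (N + 1) (akTerm (n + 1)) ≤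
      PowerSeries.coeff (N + 2) (partsAtLeast 2) -
        PowerSeries.coeff (N + 2) (partsAtLeast (M + 2)) :=
    (Finset.sum_le_sum fun n _ => coeff_akTerm_le_sub (n + 1) (N + 1)).trans_eq
      (Finset.sum_range_sub' (fun n => PowerSeries.coeff (N + 2) (partsAtLeast (n + 2))) M)
  have hnn := coeff_partsAtLeast_nonneg (by omega : 1 ≤ M + 2) (N + 2)
  have hp : partitionCount (N + 2) =
      PowerSeries.coeff (N + 2) (partsAtLeast 2) + partitionCount (N + 1) := by
    simpa [partitionCount] using coeff_partsAtLeast le_rfl (N + 2)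
  rw [Finset.sum_range_succ', akTerm_zero, PowerSeries.coeff_succ_X_mul]
  change _ + partitionCount N ≤ _
  linarith

/-! ### Euler's generating function as an analytic function -/

/-- Euler's product `(q; q)_∞ = ∏_{n ≥ 1} (1 - q^n)`, as a function of a complex number `q`. -/
noncomputable def eulerProd (q : ℂ) : ℂ := ∏' n : ℕ, (1 - q ^ (n + 1))

theorem tendsto_prod_eulerProd {q : ℂ} (hq : ‖q‖ < 1) :
    Tendsto (fun N : ℕ => ∏ j ∈ Finset.range N, (1 - q ^ (j + 1))) atTop (nhds (eulerProd q)) :=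
  (ModularForm.multipliable_one_sub_pow hq).hasProd.tendsto_prod_nat

theorem one_sub_pow_ne_zero {q : ℂ} (hq : ‖q‖ < 1) {n : ℕ} (hn : n ≠ 0) : 1 - q ^ n ≠ 0 := by
  intro h
  have h1 : ‖q ^ n‖ = 1 := by rw [← sub_eq_zero.mp h, norm_one]
  rw [norm_pow] at h1
  exact (pow_lt_one₀ (norm_nonneg q) hq hn).ne h1

theorem eulerProd_ne_zero {q : ℂ} (hq : ‖q‖ < 1) : eulerProd q ≠ 0 := by
  have hsum := (summable_nat_add_iff 1).mpr (summable_geometric_of_lt_one (norm_nonneg q) hq)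
  have := tprod_one_add_ne_zero_of_summable (f := fun n : ℕ => -q ^ (n + 1))
    (fun n => by simpa [← sub_eq_add_neg] using one_sub_pow_ne_zero hq n.succ_ne_zero)
    (by simpa using hsum)
  simpa [eulerProd, sub_eq_add_neg] using this

/-- The relation `(1 - q^s) / (q^s; q)_∞ = 1 / (q^(s+1); q)_∞` becomes an inequality for truncated
sums at `q = r ≥ 0`: the terms lost in the truncation of `q^s / (q^s; q)_∞` are nonnegative. -/
theorem partsAtLeast_truncated_sum_le {s : ℕ} (hs : 1 ≤ s) {r : ℝ} (hr : 0 ≤ r) (M : ℕ) :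
    (1 - r ^ s) * ∑ n ∈ Finset.range M, PowerSeries.coeff n (partsAtLeast s) * r ^ n ≤
      ∑ n ∈ Finset.range M, PowerSeries.coeff n (partsAtLeast (s + 1)) * r ^ n := by
  have hnn (n : ℕ) : 0 ≤ PowerSeries.coeff n (partsAtLeast s) * r ^ n :=
    mul_nonneg (coeff_partsAtLeast_nonneg hs n) (pow_nonneg hr n)
  have hsplit : ∑ n ∈ Finset.range M, PowerSeries.coeff n (partsAtLeast s) * r ^ n =
      ∑ n ∈ Finset.range M, PowerSeries.coeff n (partsAtLeast (s + 1)) * r ^ n +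
      ∑ n ∈ Finset.range M,
        (if s ≤ n then PowerSeries.coeff (n - s) (partsAtLeast s) else 0) * r ^ n := by
    rw [← Finset.sum_add_distrib]
    exact Finset.sum_congr rfl fun n _ => by rw [coeff_partsAtLeast hs n, add_mul]
  have hshift : ∑ n ∈ Finset.range M,
      (if s ≤ n then PowerSeries.coeff (n - s) (partsAtLeast s) else 0) * r ^ n ≤
      r ^ s * ∑ n ∈ Finset.range M, PowerSeries.coeff n (partsAtLeast s) * r ^ n := by
    calc _ ≤ ∑ n ∈ Finset.range (s + M),
        (if s ≤ n then PowerSeries.coeff (n - s) (partsAtLeast s) else 0) * r ^ n := by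
          refine Finset.sum_le_sum_of_subset_of_nonneg
            (Finset.range_mono (Nat.le_add_left M s)) fun n _ _ => ?_
          split_ifs
          · exact mul_nonneg (coeff_partsAtLeast_nonneg hs _) (pow_nonneg hr n)
          · simp
      _ = _ := by
          rw [Finset.sum_range_add, Finset.sum_eq_zero, zero_add, Finset.mul_sum]
          · refine Finset.sum_congr rfl fun n _ => ?_
            rw [if_pos (Nat.le_add_right s n), Nat.add_sub_cancel_left, pow_add]
            ring
          · intro n hn
            rw [if_neg (by simpa using hn), zero_mul]
  rw [sub_mul, one_mul]
  linarith

/-- The truncated sums are bounded by `1 / ∏_{j ≤ N} (1 - r^j)`, which converges as `N → ∞`. -/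
theorem summable_partitionCount_mul_pow {r : ℝ} (hr : 0 ≤ r) (hr1 : r < 1) :
    Summable fun n => partitionCount n * r ^ n := by
  have hpos (j : ℕ) : 0 < 1 - r ^ (j + 1) := sub_pos.mpr (pow_lt_one₀ hr hr1 j.succ_ne_zero)
  have hprod (M N : ℕ) : (∏ j ∈ Finset.range N, (1 - r ^ (j + 1))) *
      ∑ n ∈ Finset.range M, partitionCount n * r ^ n ≤
      ∑ n ∈ Finset.range M, PowerSeries.coeff n (partsAtLeast (N + 1)) * r ^ n := by
    induction N with
    | zero => simp [partitionCount]
    | succ N ih =>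
      rw [Finset.prod_range_succ, mul_right_comm, mul_comm]
      exact (mul_le_mul_of_nonneg_left ih (hpos N).le).trans
        (partsAtLeast_truncated_sum_le (by omega) hr M)
  have hr' : ‖(r : ℂ)‖ < 1 := by simpa [abs_of_nonneg hr] using hr1
  have hbdd := ((tendsto_prod_eulerProd hr').norm.inv₀
    (norm_ne_zero_iff.mpr (eulerProd_ne_zero hr'))).bddAbove_range
  obtain ⟨C, hC⟩ := hbdd
  refine summable_of_sum_range_le (c := C)
    (fun n => mul_nonneg (coeff_partsAtLeast_nonneg le_rfl n) (pow_nonneg hr n)) fun M => ?_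
  -- With at least as many factors removed as there are terms, only the constant term is left.
  have hone : ∑ n ∈ Finset.range M, PowerSeries.coeff n (partsAtLeast (M + 1)) * r ^ n ≤ 1 := by
    calc _ = ∑ n ∈ Finset.range M, if n = 0 then (1 : ℝ) else 0 := by
          refine Finset.sum_congr rfl fun n hn => ?_
          rw [coeff_partsAtLeast_of_lt (by have := Finset.mem_range.mp hn; omega)]
          split_ifs with h <;> simp [h]
      _ ≤ 1 := by rw [Finset.sum_ite_eq']; split_ifs <;> norm_num
  have hP : 0 < ∏ j ∈ Finset.range M, (1 - r ^ (j + 1)) := Finset.prod_pos fun j _ => hpos j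
  refine le_trans ?_ (hC ⟨M, rfl⟩)
  have hnorm : ‖∏ j ∈ Finset.range M, (1 - (r : ℂ) ^ (j + 1))‖ =
      ∏ j ∈ Finset.range M, (1 - r ^ (j + 1)) := by
    rw [← Real.norm_of_nonneg hP.le, ← Complex.norm_real]
    push_cast
    rfl
  change _ ≤ ‖∏ j ∈ Finset.range M, (1 - (r : ℂ) ^ (j + 1))‖⁻¹
  rw [hnorm, ← one_div, le_div_iff₀ hP, mul_comm]
  exact (hprod M M).trans hone

theorem summable_norm_coeff_partsAtLeast {q : ℂ} (hq : ‖q‖ < 1) {s : ℕ} (hs : 1 ≤ s) :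
    Summable fun n => ‖((PowerSeries.coeff n (partsAtLeast s) : ℝ) : ℂ) * q ^ n‖ := by
  refine Summable.of_nonneg_of_le (fun n => norm_nonneg _) (fun n => ?_)
    (summable_partitionCount_mul_pow (norm_nonneg q) hq)
  rw [norm_mul, Complex.norm_real, norm_pow, Real.norm_of_nonneg (coeff_partsAtLeast_nonneg hs n)]
  refine mul_le_mul_of_nonneg_right ?_ (pow_nonneg (norm_nonneg q) n)
  induction s, hs using Nat.le_induction with
  | base => exact le_rfl
  | succ s hs ih => exact (coeff_partsAtLeast_succ_le hs n).trans ih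

theorem tsum_coeff_partsAtLeast_succ {q : ℂ} (hq : ‖q‖ < 1) {s : ℕ} (hs : 1 ≤ s) :
    ∑' n, ((PowerSeries.coeff n (partsAtLeast (s + 1)) : ℝ) : ℂ) * q ^ n =
      (1 - q ^ s) * ∑' n, ((PowerSeries.coeff n (partsAtLeast s) : ℝ) : ℂ) * q ^ n := by
  have h1 := (summable_norm_coeff_partsAtLeast hq hs).of_norm
  have h2 := (summable_norm_coeff_partsAtLeast hq (Nat.le_add_left 1 s)).of_norm
  have hterm (n : ℕ) : ((PowerSeries.coeff n (partsAtLeast s) : ℝ) : ℂ) * q ^ n -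
      ((PowerSeries.coeff n (partsAtLeast (s + 1)) : ℝ) : ℂ) * q ^ n =
      if s ≤ n then ((PowerSeries.coeff (n - s) (partsAtLeast s) : ℝ) : ℂ) * q ^ n else 0 := by
    rw [coeff_partsAtLeast hs n]
    split_ifs <;> push_cast <;> ring
  have h3 := (h1.sub h2).sum_add_tsum_nat_add s
  rw [h1.tsum_sub h2, Finset.sum_eq_zero, zero_add] at h3
  · have h4 : ∑' n : ℕ, (((PowerSeries.coeff (n + s) (partsAtLeast s) : ℝ) : ℂ) * q ^ (n + s) -
        ((PowerSeries.coeff (n + s) (partsAtLeast (s + 1)) : ℝ) : ℂ) * q ^ (n + s)) =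
        q ^ s * ∑' n, ((PowerSeries.coeff n (partsAtLeast s) : ℝ) : ℂ) * q ^ n := by
      rw [← tsum_mul_left]
      refine tsum_congr fun n => ?_
      rw [hterm, if_pos (Nat.le_add_left s n), Nat.add_sub_cancel, pow_add]
      ring
    rw [h4] at h3
    linear_combination h3
  · intro n hn
    rw [hterm, if_neg (by simpa using hn)]

/-- Euler's generating function: `∑ p(n) q^n = 1 / (q; q)_∞` for complex `|q| < 1`. -/
theorem hasSum_partitionCount {q : ℂ} (hq : ‖q‖ < 1) :
    HasSum (fun n => (partitionCount n : ℂ) * q ^ n) (eulerProd q)⁻¹ := by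
  have hprod (N : ℕ) : ∑' n, ((PowerSeries.coeff n (partsAtLeast (N + 1)) : ℝ) : ℂ) * q ^ n =
      (∏ j ∈ Finset.range N, (1 - q ^ (j + 1))) * ∑' n, (partitionCount n : ℂ) * q ^ n := by
    induction N with
    | zero => simp [partitionCount]
    | succ N ih =>
      rw [tsum_coeff_partsAtLeast_succ hq (by omega), ih, Finset.prod_range_succ]
      ring
  -- As `N → ∞`, the partitions into parts larger than `N` reduce to the empty one.
  have hlim : Tendsto (fun N : ℕ =>
      ∑' n, ((PowerSeries.coeff n (partsAtLeast (N + 1)) : ℝ) : ℂ) * q ^ n) atTop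
      (nhds (∑' n : ℕ, if n = 0 then (1 : ℂ) else 0)) := by
    refine tendsto_tsum_of_dominated_convergence
      (summable_norm_coeff_partsAtLeast hq le_rfl) (fun n => ?_)
      (Eventually.of_forall fun N n => ?_)
    · refine tendsto_const_nhds.congr' ?_
      filter_upwards [eventually_ge_atTop n] with N hN
      rw [coeff_partsAtLeast_of_lt (by omega)]
      split_ifs with h <;> simp [h]
    · rw [norm_mul, norm_mul, Complex.norm_real, Complex.norm_real,
        Real.norm_of_nonneg (coeff_partsAtLeast_nonneg (by omega) n),
        Real.norm_of_nonneg (coeff_partsAtLeast_nonneg le_rfl n)]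
      refine mul_le_mul_of_nonneg_right ?_ (norm_nonneg _)
      induction N with
      | zero => exact le_rfl
      | succ N ih => exact (coeff_partsAtLeast_succ_le (by omega) n).trans ih
  simp_rw [hprod] at hlim
  rw [tsum_ite_eq] at hlim
  have heq := tendsto_nhds_unique hlim ((tendsto_prod_eulerProd hq).mul_const _)
  rw [← eq_inv_of_mul_eq_one_right heq.symm]
  exact (summable_norm_coeff_partsAtLeast hq le_rfl).of_norm.hasSum

/-! ### The generating function away from the positive real axis -/

/-- Here `|1 - w|² = (1 - |w|)² + a` with `a = 2 (|w| - Re w) ∈ [0, 4]`, which is at least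
`(1 - |w|)² (1 + a)`, and `e^(a/4) ≤ 1 + a` on that range. -/
theorem one_sub_norm_sq_mul_exp_le {w : ℂ} (hw : ‖w‖ ≤ 1) :
    (1 - ‖w‖) ^ 2 * Real.exp ((‖w‖ - w.re) / 2) ≤ ‖1 - w‖ ^ 2 := by
  have hre := abs_le.mp (Complex.abs_re_le_norm w)
  have hn := norm_nonneg w
  have hsq : ‖1 - w‖ ^ 2 = (1 - ‖w‖) ^ 2 + 2 * (‖w‖ - w.re) := by
    have h1 : ‖w‖ ^ 2 = w.re ^ 2 + w.im ^ 2 := by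
      rw [Complex.sq_norm, Complex.normSq_apply]; ring
    have h2 : ‖1 - w‖ ^ 2 = (1 - w.re) ^ 2 + w.im ^ 2 := by
      rw [Complex.sq_norm, Complex.normSq_apply]; simp; ring
    linarith
  have hexp : Real.exp ((‖w‖ - w.re) / 2) ≤ 1 + 2 * (‖w‖ - w.re) := by
    have h := (abs_le.mp (Real.abs_exp_sub_one_sub_id_le
      (x := (‖w‖ - w.re) / 2) (abs_le.mpr ⟨by linarith, by linarith⟩))).2
    nlinarith
  rw [hsq]
  calc _ ≤ (1 - ‖w‖) ^ 2 * (1 + 2 * (‖w‖ - w.re)) :=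
        mul_le_mul_of_nonneg_left hexp (sq_nonneg _)
    _ ≤ _ := by
      have h1 : (1 - ‖w‖) ^ 2 ≤ 1 := by nlinarith
      nlinarith [mul_le_mul_of_nonneg_right h1 (by linarith : 0 ≤ 2 * (‖w‖ - w.re))]

theorem eulerProd_sq_mul_exp_le {q : ℂ} (hq : ‖q‖ < 1) :
    ‖eulerProd (‖q‖ : ℂ)‖ ^ 2 * Real.exp (((1 - ‖q‖)⁻¹ - ((1 - q)⁻¹).re) / 2) ≤
      ‖eulerProd q‖ ^ 2 := by
  have hq' : ‖((‖q‖ : ℝ) : ℂ)‖ < 1 := by simpa using hq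
  have hne : 1 - ‖q‖ ≠ 0 := by linarith
  have hne' : 1 - q ≠ 0 := by simpa using one_sub_pow_ne_zero hq one_ne_zero
  have hs1 : Tendsto (fun N => ∑ j ∈ Finset.range N, ‖q‖ ^ (j + 1)) atTop
      (nhds ((1 - ‖q‖)⁻¹ - 1)) := by
    have h := ((hasSum_geometric_of_lt_one (norm_nonneg q) hq).mul_right ‖q‖).tendsto_sum_nat
    have h2 : (1 - ‖q‖)⁻¹ * ‖q‖ = (1 - ‖q‖)⁻¹ - 1 := by
      linear_combination -inv_mul_cancel₀ hne
    rw [h2] at h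
    simpa [← pow_succ] using h
  have hs2 : Tendsto (fun N => ∑ j ∈ Finset.range N, (q ^ (j + 1)).re) atTop
      (nhds (((1 - q)⁻¹).re - 1)) := by
    have h := ((hasSum_geometric_of_norm_lt_one hq).mul_right q).tendsto_sum_nat
    have h2 : (1 - q)⁻¹ * q = (1 - q)⁻¹ - 1 := by
      field_simp
      ring
    rw [h2] at h
    have h3 := (Complex.continuous_re.tendsto _).comp h
    simpa [Function.comp_def, Complex.re_sum, ← pow_succ] using h3
  have hlim := ((tendsto_prod_eulerProd hq').norm.pow 2).mul
    ((Real.continuous_exp.tendsto _).comp ((hs1.sub hs2).div_const 2))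
  rw [show (1 - ‖q‖)⁻¹ - 1 - (((1 - q)⁻¹).re - 1) = (1 - ‖q‖)⁻¹ - ((1 - q)⁻¹).re by ring] at hlim
  refine le_of_tendsto_of_tendsto' hlim ((tendsto_prod_eulerProd hq).norm.pow 2) fun N => ?_
  rw [Function.comp_apply, ← Finset.sum_sub_distrib, Finset.sum_div, Real.exp_sum, norm_prod,
    norm_prod, ← Finset.prod_pow, ← Finset.prod_pow, ← Finset.prod_mul_distrib]
  refine Finset.prod_le_prod (fun j _ => by positivity) fun j _ => ?_
  have hw : ‖q ^ (j + 1)‖ ≤ 1 := by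
    rw [norm_pow]; exact pow_le_one₀ (norm_nonneg q) hq.le
  have h := one_sub_norm_sq_mul_exp_le hw
  have h1 : ‖1 - ((‖q‖ : ℝ) : ℂ) ^ (j + 1)‖ = 1 - ‖q ^ (j + 1)‖ := by
    rw [norm_pow, ← Real.norm_of_nonneg (sub_nonneg.mpr (norm_pow q _ ▸ hw)), ← Complex.norm_real]
    push_cast
    rfl
  rwa [h1, ← norm_pow]

/-- On the circle `|q| = r` the generating function `1 / (q; q)_∞` is largest at `q = r`, with an
exponential saving in terms of the gap `1 / (1 - r) - Re (1 / (1 - q))`. -/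
theorem norm_inv_eulerProd_le {q : ℂ} (hq : ‖q‖ < 1) :
    ‖(eulerProd q)⁻¹‖ ≤ ‖(eulerProd (‖q‖ : ℂ))⁻¹‖ *
      Real.exp (-(((1 - ‖q‖)⁻¹ - ((1 - q)⁻¹).re) / 4)) := by
  have hq' : ‖((‖q‖ : ℝ) : ℂ)‖ < 1 := by simpa using hq
  have h1 := norm_pos_iff.mpr (eulerProd_ne_zero hq)
  have h2 := norm_pos_iff.mpr (eulerProd_ne_zero hq')
  set D := (1 - ‖q‖)⁻¹ - ((1 - q)⁻¹).re with hD
  have h3 : ‖eulerProd (‖q‖ : ℂ)‖ * Real.exp (D / 4) ≤ ‖eulerProd q‖ := by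
    refine le_of_sq_le_sq ?_ h1.le
    rw [mul_pow, ← Real.exp_nat_mul]
    rw [show ((2 : ℕ) : ℝ) * (D / 4) = D / 2 by push_cast; ring]
    exact eulerProd_sq_mul_exp_le hq
  rw [norm_inv, norm_inv, Real.exp_neg, ← mul_inv]
  exact inv_anti₀ (by positivity) h3

/-- With `r = e^(-x)`, `d = 1 - r` and `t = r (1 - cos y)` the gap equals
`t (1 + r) / (d (d² + 2 t))`; the bound follows from `d ≤ x` and `t ≥ y² / 15`. -/
theorem inv_one_sub_gap_ge {x y : ℝ} (hx : 0 < x) (hx1 : x ≤ 1) (hy : |y| ≤ Real.pi) :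
    y ^ 2 / (x * (15 * x ^ 2 + 2 * y ^ 2)) ≤
      (1 - Real.exp (-x))⁻¹ - ((1 - Complex.exp (-x + y * Complex.I))⁻¹).re := by
  set r := Real.exp (-x) with hr
  have hr3 : 1 / 3 ≤ r := by
    have h1 : Real.exp (-1) ≤ r := Real.exp_le_exp.mpr (by linarith)
    have h2 : 1 / 3 ≤ Real.exp (-1) := by
      rw [Real.exp_neg, ← one_div]
      exact one_div_le_one_div_of_le (Real.exp_pos _) (by linarith [Real.exp_one_lt_d9])
    linarith
  have hr1 : r < 1 := by rw [hr, Real.exp_lt_one_iff]; linarith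
  have hd : 1 - r ≤ x := by linarith [Real.add_one_le_exp (-x)]
  have hd0 : 0 < 1 - r := by linarith
  have hc : y ^ 2 / 5 ≤ 1 - Real.cos y := by
    have h1 := Real.cos_le_one_sub_mul_cos_sq hy
    have h2 : 1 / 5 ≤ 2 / Real.pi ^ 2 := by
      rw [div_le_div_iff₀ (by norm_num) (by positivity)]
      nlinarith [Real.pi_lt_d2, Real.pi_pos]
    nlinarith [mul_le_mul_of_nonneg_right h2 (sq_nonneg y)]
  set t := r * (1 - Real.cos y) with ht
  have ht1 : y ^ 2 / 15 ≤ t := by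
    have := mul_le_mul hr3 hc (by positivity) (by linarith)
    linarith
  have ht0 : 0 ≤ t := le_trans (by positivity) ht1
  have hq : Complex.exp (-x + y * Complex.I) = ⟨r * Real.cos y, r * Real.sin y⟩ := by
    apply Complex.ext <;> simp [Complex.exp_re, Complex.exp_im, hr]
  have hre : ((1 - Complex.exp (-x + y * Complex.I))⁻¹).re =
      ((1 - r) + t) / ((1 - r) ^ 2 + 2 * t) := by
    rw [hq, Complex.inv_re, Complex.normSq_apply]
    simp only [Complex.sub_re, Complex.sub_im, Complex.one_re, Complex.one_im]
    congr 1
    · rw [ht]; ring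
    · rw [ht]; linear_combination r ^ 2 * Real.sin_sq_add_cos_sq y
  have hgap : (1 - r)⁻¹ - ((1 - r) + t) / ((1 - r) ^ 2 + 2 * t) =
      t * (1 + r) / ((1 - r) * ((1 - r) ^ 2 + 2 * t)) := by
    field_simp
    ring
  rw [hre, hgap]
  calc y ^ 2 / (x * (15 * x ^ 2 + 2 * y ^ 2)) ≤ t / (x * (x ^ 2 + 2 * t)) := by
        rw [div_le_div_iff₀ (by positivity) (by positivity)]
        have : y ^ 2 * x ^ 3 ≤ 15 * t * x ^ 3 :=
          mul_le_mul_of_nonneg_right (by linarith) (by positivity)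
        nlinarith
    _ ≤ t / ((1 - r) * ((1 - r) ^ 2 + 2 * t)) := by
        refine div_le_div_of_nonneg_left ht0 (by positivity) ?_
        refine mul_le_mul hd ?_ (by positivity) hx.le
        nlinarith
    _ ≤ _ := by
        refine div_le_div_of_nonneg_right ?_ (by positivity)
        nlinarith

/-- An integrable majorant, uniform in `x`, of the normalized generating function on the circle of
radius `e^(-x)` in the variable `v = x^(-3/2) arg q`. The Gaussian term accounts for the `v` with
`x v^2 ≤ 1`; for the other ones the saving `e^(-1/(68 x))` beats every power of `x`. -/
noncomputable def arcMajorant (v : ℝ) : ℝ :=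
  Real.exp (-(1 / 68) * v ^ 2) + 120 * 68 ^ 3 * (1 + v ^ 2)⁻¹

theorem integrable_arcMajorant : MeasureTheory.Integrable arcMajorant :=
  (integrable_exp_neg_mul_sq (by norm_num)).add (integrable_inv_one_add_sq.const_mul _)

theorem exp_neg_gap_le_arcMajorant {x v : ℝ} (hx : 0 < x) (hx1 : x ≤ 1)
    (hv : |x * √x * v| ≤ Real.pi) :
    Real.exp (-(((1 - Real.exp (-x))⁻¹ -
      ((1 - Complex.exp (-x + (x * √x * v : ℝ) * Complex.I))⁻¹).re) / 4)) ≤ arcMajorant v := by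
  have hy : (x * √x * v) ^ 2 = x ^ 3 * v ^ 2 := by
    rw [mul_pow, mul_pow, Real.sq_sqrt hx.le]; ring
  have hgap := inv_one_sub_gap_ge hx hx1 hv
  rw [hy, show x ^ 3 * v ^ 2 / (x * (15 * x ^ 2 + 2 * (x ^ 3 * v ^ 2))) =
    v ^ 2 / (15 + 2 * (x * v ^ 2)) by field_simp] at hgap
  unfold arcMajorant
  rcases le_or_gt (x * v ^ 2) 1 with h | h
  · refine le_add_of_le_of_nonneg (Real.exp_le_exp.mpr ?_) (by positivity)
    have : v ^ 2 / 17 ≤ v ^ 2 / (15 + 2 * (x * v ^ 2)) :=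
      div_le_div_of_nonneg_left (sq_nonneg v) (by positivity) (by linarith)
    linarith
  · refine le_add_of_nonneg_of_le (Real.exp_pos _).le ?_
    have hv0 : 0 < v ^ 2 := by
      by_contra hcon
      nlinarith
    have h1 : 1 / (17 * x) ≤ v ^ 2 / (15 + 2 * (x * v ^ 2)) := by
      rw [div_le_div_iff₀ (by positivity) (by positivity)]
      nlinarith
    -- The cube is what is needed: `x³ v² = y² ≤ π²` turns `x³` into a multiple of `1 / v²`.
    have h2 : (1 / (68 * x)) ^ 3 / 6 ≤ Real.exp (1 / (68 * x)) := by
      simpa [Nat.factorial] using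
        Real.pow_div_factorial_le_exp (1 / (68 * x)) (by positivity) 3
    have h3 : x ^ 3 * v ^ 2 ≤ 10 := by
      rw [← hy, ← sq_abs]
      nlinarith [Real.pi_lt_d2, Real.pi_pos, abs_nonneg (x * √x * v)]
    have h4 : 1 ≤ v ^ 2 := by nlinarith
    have h5 : Real.exp (-(1 / (68 * x))) ≤ 6 * (68 * x) ^ 3 := by
      rw [Real.exp_neg]
      refine (inv_anti₀ (by positivity) h2).trans_eq ?_
      field_simp
    refine (Real.exp_le_exp.mpr (?_ : _ ≤ -(1 / (68 * x)))).trans (h5.trans ?_)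
    · have : 1 / (68 * x) = 1 / (17 * x) / 4 := by field_simp; norm_num
      linarith
    · rw [← div_eq_mul_inv, le_div_iff₀ (by positivity)]
      have h6 : x ^ 3 * (1 + v ^ 2) ≤ 20 := by
        nlinarith [pow_pos hx 3]
      nlinarith

/-! ### The generating function near `q = 1` -/

/-- Dedekind's eta function at `τ = i w / 2π`, where `e^(2πiτ) = e^(-w)`. -/
theorem eta_I_mul_div_two_pi (w : ℂ) :
    ModularForm.eta (Complex.I * w / (2 * Real.pi)) =
      Complex.exp (-w / 24) * eulerProd (Complex.exp (-w)) := by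
  have hpi : (Real.pi : ℂ) ≠ 0 := Complex.ofReal_ne_zero.mpr Real.pi_ne_zero
  have harg : 2 * Real.pi * Complex.I * (Complex.I * w / (2 * Real.pi)) = -w := by
    field_simp
    linear_combination w * Complex.I_sq
  rw [ModularForm.eta, eulerProd]
  simp only [ModularForm.eta_q_eq_pow, Function.Periodic.qParam, harg, Complex.ofReal_ofNat]

/-- The transformation of Dedekind's eta function under `τ ↦ -1 / τ`, written for the generating
function of the partitions at `q = e^(-z)`. -/
theorem inv_eulerProd_exp_neg {z : ℂ} (hz : 0 < z.re) :
    (eulerProd (Complex.exp (-z)))⁻¹ =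
      Complex.exp (Real.pi ^ 2 / (6 * z) - z / 24) *
        (Complex.sqrt (Complex.I * z / (2 * Real.pi)) / Complex.sqrt Complex.I) *
          (eulerProd (Complex.exp (-(4 * Real.pi ^ 2 / z))))⁻¹ := by
  have hpi : (Real.pi : ℂ) ≠ 0 := Complex.ofReal_ne_zero.mpr Real.pi_ne_zero
  have hz0 : z ≠ 0 := fun h => by simp [h] at hz
  have him : Complex.I * z / (2 * Real.pi) ∈ UpperHalfPlane.upperHalfPlaneSet := by
    have : Complex.I * z / (2 * Real.pi) = Complex.I * z / ((2 * Real.pi : ℝ) : ℂ) := by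
      push_cast; rfl
    change 0 < (Complex.I * z / (2 * Real.pi)).im
    rw [this, Complex.div_ofReal_im, Complex.I_mul_im]
    positivity
  have heta := ModularForm.eta_comp_eq_csqrt_I_inv him
  have hinv : -1 / (Complex.I * z / (2 * Real.pi)) =
      Complex.I * (4 * Real.pi ^ 2 / z) / (2 * Real.pi) := by
    field_simp
    linear_combination -4 * Complex.I_sq
  simp only [Function.comp_apply, Pi.smul_apply, Pi.mul_apply, smul_eq_mul] at heta
  rw [hinv, eta_I_mul_div_two_pi, eta_I_mul_div_two_pi] at heta
  have hre : 0 < (4 * Real.pi ^ 2 / z : ℂ).re := by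
    have : (4 * Real.pi ^ 2 / z : ℂ) = ((4 * Real.pi ^ 2 : ℝ) : ℂ) * z⁻¹ := by
      push_cast; rfl
    rw [this, Complex.re_ofReal_mul, Complex.inv_re]
    have := Complex.normSq_pos.mpr hz0
    positivity
  have hE1 : eulerProd (Complex.exp (-z)) ≠ 0 := eulerProd_ne_zero (by
    rw [Complex.norm_exp, Real.exp_lt_one_iff]; simpa using hz)
  have hE2 : eulerProd (Complex.exp (-(4 * Real.pi ^ 2 / z))) ≠ 0 := eulerProd_ne_zero (by
    rw [Complex.norm_exp, Real.exp_lt_one_iff, Complex.neg_re]; linarith)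
  have hexp : Complex.exp (Real.pi ^ 2 / (6 * z) - z / 24) *
      Complex.exp (-(4 * Real.pi ^ 2 / z) / 24) = Complex.exp (-z / 24) := by
    rw [← Complex.exp_add]
    congr 1
    field_simp
    ring
  have hA := Complex.exp_ne_zero (-(4 * Real.pi ^ 2 / z) / 24)
  have hcancel : eulerProd (Complex.exp (-(4 * Real.pi ^ 2 / z))) =
      Complex.exp (Real.pi ^ 2 / (6 * z) - z / 24) *
        (Complex.sqrt (Complex.I * z / (2 * Real.pi)) / Complex.sqrt Complex.I) *
          eulerProd (Complex.exp (-z)) := by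
    refine mul_left_cancel₀ hA ?_
    rw [heta, ← hexp]
    ring
  rw [inv_eq_iff_eq_inv, mul_inv, inv_inv, eq_inv_mul_iff_mul_eq₀ ?_, ← hcancel]
  exact fun h => hE2 (by rw [hcancel, h, zero_mul])

theorem continuousOn_eulerProd : ContinuousOn eulerProd (Metric.ball 0 1) :=
  ModularForm.differentiableOn_tprod_one_sub_pow.continuousOn

theorem eulerProd_zero : eulerProd 0 = 1 := by simp [eulerProd]

/-- The value that the generating function of the partitions takes at `e^(-x)`, to leading order
as `x → 0`. -/
noncomputable def realScale (x : ℝ) : ℝ := √(x / (2 * Real.pi)) * Real.exp (Real.pi ^ 2 / (6 * x))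

theorem realScale_pos {x : ℝ} (hx : 0 < x) : 0 < realScale x := by
  have := Real.pi_pos
  unfold realScale
  positivity

theorem sqrt_ofReal_mul {r : ℝ} (hr : 0 < r) (w : ℂ) :
    Complex.sqrt (r * w) = √r * Complex.sqrt w := by
  rcases eq_or_ne w 0 with rfl | hw
  · simp
  have hr' : (r : ℂ) ≠ 0 := Complex.ofReal_ne_zero.mpr hr.ne'
  have h1 : (√r : ℂ) = Complex.exp (Real.log r * 2⁻¹) := by
    rw [Real.sqrt_eq_rpow, Real.rpow_def_of_pos hr]
    push_cast
    norm_num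
  rw [Complex.sqrt, Complex.sqrt, Complex.cpow_def_of_ne_zero (mul_ne_zero hr' hw),
    Complex.cpow_def_of_ne_zero hw, Complex.log_ofReal_mul hr hw, add_mul, Complex.exp_add, h1]

/-- With `z = x (1 - i √x v)` and `n = π² / (6 x²)`, the saddle point, the terms of order
`x^(-1)` and `x^(-1/2)` in the exponent cancel. -/
theorem inv_eulerProd_scaled_eq {x : ℝ} (hx : 0 < x) (v : ℝ) :
    (eulerProd (Complex.exp (-x + (x * √x * v : ℝ) * Complex.I)))⁻¹ *
      Complex.exp (-(Real.pi ^ 2 / (6 * x ^ 2) * (x * √x * v) : ℝ) * Complex.I) / realScale x =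
    Complex.exp (-(Real.pi ^ 2 * v ^ 2 / (6 * (1 - √x * v * Complex.I))) -
        x * (1 - √x * v * Complex.I) / 24) *
      (Complex.sqrt (Complex.I * (1 - √x * v * Complex.I)) / Complex.sqrt Complex.I) *
      (eulerProd (Complex.exp (-(4 * Real.pi ^ 2 / (x * (1 - √x * v * Complex.I))))))⁻¹ := by
  have hpi : (Real.pi : ℂ) ≠ 0 := Complex.ofReal_ne_zero.mpr Real.pi_ne_zero
  have hx0 : (x : ℂ) ≠ 0 := Complex.ofReal_ne_zero.mpr hx.ne'
  have hs0 : (√x : ℂ) ≠ 0 := Complex.ofReal_ne_zero.mpr (Real.sqrt_pos.mpr hx).ne'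
  have hsx : (x : ℂ) = √x ^ 2 := by
    rw [← Complex.ofReal_pow, Real.sq_sqrt hx.le]
  set u : ℂ := 1 - √x * v * Complex.I with hu
  have hure : u.re = 1 := by simp [hu]
  have hu0 : u ≠ 0 := fun h => by simp [h] at hure
  have hz : (-x + (x * √x * v : ℝ) * Complex.I : ℂ) = -(x * u) := by
    rw [hu]; push_cast; ring
  have hzre : 0 < (x * u : ℂ).re := by rw [Complex.re_ofReal_mul, hure]; linarith
  have hsqrt : Complex.sqrt (Complex.I * (x * u) / (2 * Real.pi)) =
      √(x / (2 * Real.pi)) * Complex.sqrt (Complex.I * u) := by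
    rw [← sqrt_ofReal_mul (by positivity)]
    congr 1
    push_cast
    ring
  have hR : (√(x / (2 * Real.pi)) : ℂ) ≠ 0 :=
    Complex.ofReal_ne_zero.mpr (Real.sqrt_pos.mpr (by positivity)).ne'
  have hexp : Complex.exp (Real.pi ^ 2 / (6 * (x * u)) - x * u / 24) *
      Complex.exp (-(Real.pi ^ 2 / (6 * x ^ 2) * (x * √x * v) : ℝ) * Complex.I) =
      Complex.exp (-(Real.pi ^ 2 * v ^ 2 / (6 * u)) - x * u / 24) *
        Complex.exp (Real.pi ^ 2 / (6 * x)) := by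
    rw [← Complex.exp_add, ← Complex.exp_add]
    congr 1
    push_cast
    rw [hsx]
    field_simp
    rw [hu]
    ring_nf
    rw [Complex.I_sq]
    ring
  have hscale : (realScale x : ℂ) =
      √(x / (2 * Real.pi)) * Complex.exp (Real.pi ^ 2 / (6 * x)) := by
    rw [realScale]; push_cast; rfl
  rw [hz, inv_eulerProd_exp_neg hzre, hsqrt, hscale,
    div_eq_iff (mul_ne_zero hR (Complex.exp_ne_zero _))]
  linear_combination (√(x / (2 * Real.pi)) * Complex.sqrt (Complex.I * u) / Complex.sqrt Complex.I *
    (eulerProd (Complex.exp (-(4 * Real.pi ^ 2 / (x * u)))))⁻¹) * hexp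

/-- Every factor of `inv_eulerProd_scaled_eq` but the exponential tends to `1`: the square root
because `z / x → 1`, the dual product because `Re (1 / z) → ∞`. -/
theorem tendsto_inv_eulerProd_scaled (v : ℝ) :
    Tendsto (fun x : ℝ => (eulerProd (Complex.exp (-x + (x * √x * v : ℝ) * Complex.I)))⁻¹ *
      Complex.exp (-(Real.pi ^ 2 / (6 * x ^ 2) * (x * √x * v) : ℝ) * Complex.I) / realScale x)
      (nhdsWithin 0 (Set.Ioi 0)) (nhds (Real.exp (-(Real.pi ^ 2 / 6) * v ^ 2) : ℂ)) := by
  have hu : Tendsto (fun x : ℝ => (1 - √x * v * Complex.I : ℂ)) (nhdsWithin 0 (Set.Ioi 0))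
      (nhds 1) := by
    have : Continuous fun x : ℝ => (1 - √x * v * Complex.I : ℂ) := by fun_prop
    have h := (this.tendsto 0).mono_left (nhdsWithin_le_nhds (s := Set.Ioi 0))
    simpa using h
  have hx : Tendsto (fun x : ℝ => (x : ℂ)) (nhdsWithin 0 (Set.Ioi 0)) (nhds 0) := by
    simpa using (Complex.continuous_ofReal.tendsto 0).mono_left
      (nhdsWithin_le_nhds (s := Set.Ioi 0))
  have hexp : Tendsto (fun x : ℝ => Complex.exp
      (-(Real.pi ^ 2 * v ^ 2 / (6 * (1 - √x * v * Complex.I))) -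
        x * (1 - √x * v * Complex.I) / 24)) (nhdsWithin 0 (Set.Ioi 0))
      (nhds (Real.exp (-(Real.pi ^ 2 / 6) * v ^ 2) : ℂ)) := by
    have h := (Complex.continuous_exp.tendsto _).comp
      (((tendsto_const_nhds (x := (Real.pi ^ 2 * v ^ 2 : ℂ))).div (hu.const_mul 6)
        (by norm_num)).neg.sub ((hx.mul hu).div_const 24))
    have hval : ((Real.exp (-(Real.pi ^ 2 / 6) * v ^ 2) : ℝ) : ℂ) =
        Complex.exp (-(Real.pi ^ 2 * v ^ 2 / (6 * 1)) - 0 * 1 / 24) := by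
      rw [Complex.ofReal_exp]
      push_cast
      congr 1
      ring
    rw [hval]
    exact h
  have hsqrt : Tendsto (fun x : ℝ => Complex.sqrt (Complex.I * (1 - √x * v * Complex.I)) /
      Complex.sqrt Complex.I) (nhdsWithin 0 (Set.Ioi 0)) (nhds 1) := by
    have hI : Complex.sqrt Complex.I ≠ 0 := by
      rw [Complex.sqrt, Complex.cpow_def_of_ne_zero Complex.I_ne_zero]
      exact Complex.exp_ne_zero _
    have hc : ContinuousAt Complex.sqrt (Complex.I * 1) :=
      Complex.continuousAt_sqrt (by simp)
    have h := (hc.tendsto.comp (hu.const_mul Complex.I)).div_const (Complex.sqrt Complex.I)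
    rwa [mul_one, div_self hI] at h
  have hdual : Tendsto (fun x : ℝ => Complex.exp
      (-(4 * Real.pi ^ 2 / (x * (1 - √x * v * Complex.I))))) (nhdsWithin 0 (Set.Ioi 0))
      (nhds 0) := by
    rw [Complex.tendsto_exp_nhds_zero_iff]
    have hre : Tendsto (fun x : ℝ => ((1 - √x * v * Complex.I : ℂ)⁻¹).re)
        (nhdsWithin 0 (Set.Ioi 0)) (nhds 1) := by
      have h := (Complex.continuous_re.tendsto _).comp (hu.inv₀ one_ne_zero)
      rwa [inv_one, Complex.one_re] at h
    have h := tendsto_neg_atTop_atBot.comp ((tendsto_inv_nhdsGT_zero (𝕜 := ℝ)).atTop_mul_pos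
      (by positivity : 0 < 4 * Real.pi ^ 2 * 1) (hre.const_mul (4 * Real.pi ^ 2)))
    refine h.congr fun x => ?_
    rw [Function.comp_apply, Complex.neg_re]
    have : (4 * Real.pi ^ 2 / (x * (1 - √x * v * Complex.I)) : ℂ) =
        ((x⁻¹ * (4 * Real.pi ^ 2) : ℝ) : ℂ) * (1 - √x * v * Complex.I)⁻¹ := by
      push_cast
      rw [div_eq_mul_inv, mul_inv]
      ring
    rw [this, Complex.re_ofReal_mul]
    ring
  have hE : Tendsto (fun x : ℝ => (eulerProd (Complex.exp
      (-(4 * Real.pi ^ 2 / (x * (1 - √x * v * Complex.I))))))⁻¹) (nhdsWithin 0 (Set.Ioi 0))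
      (nhds 1) := by
    have hc : ContinuousAt eulerProd 0 :=
      continuousOn_eulerProd.continuousAt (Metric.ball_mem_nhds 0 one_pos)
    have h := (hc.tendsto.comp hdual).inv₀ (by rw [eulerProd_zero]; exact one_ne_zero)
    rwa [eulerProd_zero, inv_one] at h
  have hall := (hexp.mul hsqrt).mul hE
  rw [mul_one, mul_one] at hall
  refine hall.congr' ?_
  filter_upwards [self_mem_nhdsWithin] with x hx
  exact (inv_eulerProd_scaled_eq hx v).symm

theorem tendsto_norm_inv_eulerProd_div_realScale :
    Tendsto (fun x : ℝ => ‖(eulerProd (Real.exp (-x) : ℂ))⁻¹‖ / realScale x)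
      (nhdsWithin 0 (Set.Ioi 0)) (nhds 1) := by
  have h := (tendsto_inv_eulerProd_scaled 0).norm
  simp only [mul_zero, Complex.ofReal_zero, zero_mul, add_zero, neg_zero, Complex.exp_zero,
    mul_one, norm_div, ne_eq, OfNat.ofNat_ne_zero, not_false_eq_true, zero_pow, Real.exp_zero,
    Complex.ofReal_one, norm_one] at h
  refine h.congr' ?_
  filter_upwards [self_mem_nhdsWithin] with x hx
  rw [Complex.norm_real, Real.norm_of_nonneg (realScale_pos hx).le]
  push_cast
  rfl

/-! ### Cauchy's formula and the Hardy–Ramanujan asymptotics -/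

theorem integral_exp_int_mul_I (m : ℤ) :
    ∫ y in (-Real.pi)..Real.pi, Complex.exp (m * y * Complex.I) =
      (if m = 0 then 2 * Real.pi else 0 : ℂ) := by
  split_ifs with hm
  · simp [hm]
    ring
  · have hc : (m * Complex.I : ℂ) ≠ 0 := mul_ne_zero (Int.cast_ne_zero.mpr hm) Complex.I_ne_zero
    have h := integral_exp_mul_complex (a := -Real.pi) (b := Real.pi) hc
    simp_rw [mul_right_comm _ Complex.I] at h
    rw [h, div_eq_zero_iff, sub_eq_zero, Complex.exp_eq_exp_iff_exists_int]
    refine Or.inl ⟨m, ?_⟩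
    push_cast
    ring

theorem norm_exp_neg_add_mul_I (x y : ℝ) :
    ‖Complex.exp (-x + y * Complex.I)‖ = Real.exp (-x) := by
  simp [Complex.norm_exp]

theorem norm_exp_neg_ofReal_mul_I (t : ℝ) : ‖Complex.exp (-(t : ℝ) * Complex.I)‖ = 1 := by
  rw [← Complex.ofReal_neg, Complex.norm_exp_ofReal_mul_I]

theorem continuous_inv_eulerProd_circle {x : ℝ} (hx : 0 < x) :
    Continuous fun y : ℝ => (eulerProd (Complex.exp (-x + y * Complex.I)))⁻¹ := by
  have hlt (y : ℝ) : ‖Complex.exp (-x + y * Complex.I)‖ < 1 := by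
    rw [norm_exp_neg_add_mul_I, Real.exp_lt_one_iff]
    linarith
  refine Continuous.inv₀ ?_ fun y => eulerProd_ne_zero (hlt y)
  exact continuousOn_eulerProd.comp_continuous (by fun_prop)
    fun y => mem_ball_zero_iff.mpr (hlt y)

/-- Cauchy's formula for the number of partitions, on the circle of radius `e^(-x)`. -/
theorem integral_circle_eq_partitionCount {x : ℝ} (hx : 0 < x) (n : ℕ) :
    ∫ y in (-Real.pi)..Real.pi, (eulerProd (Complex.exp (-x + y * Complex.I)))⁻¹ *
      Complex.exp (-(n * y : ℝ) * Complex.I) =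
      (2 * Real.pi * partitionCount n * Real.exp (-(n * x)) : ℝ) := by
  have hr1 : Real.exp (-x) < 1 := by rw [Real.exp_lt_one_iff]; linarith
  have hterm (k : ℕ) (y : ℝ) : (partitionCount k : ℂ) * Complex.exp (-x + y * Complex.I) ^ k *
      Complex.exp (-(n * y : ℝ) * Complex.I) =
      (partitionCount k * Real.exp (-x) ^ k : ℝ) *
        Complex.exp (((k : ℤ) - (n : ℤ) : ℤ) * y * Complex.I) := by
    push_cast
    rw [← Complex.exp_nat_mul, ← Complex.exp_nat_mul, mul_assoc, ← Complex.exp_add, mul_assoc,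
      ← Complex.exp_add]
    congr 2
    ring
  have hsum : HasSum (fun k => ∫ y in (-Real.pi)..Real.pi,
      (partitionCount k : ℂ) * Complex.exp (-x + y * Complex.I) ^ k *
        Complex.exp (-(n * y : ℝ) * Complex.I))
      (∫ y in (-Real.pi)..Real.pi, (eulerProd (Complex.exp (-x + y * Complex.I)))⁻¹ *
        Complex.exp (-(n * y : ℝ) * Complex.I)) := by
    refine intervalIntegral.hasSum_integral_of_dominated_convergence
      (fun k _ => partitionCount k * Real.exp (-x) ^ k) (fun k => ?_) (fun k => ?_) ?_ ?_ ?_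
    · exact Continuous.aestronglyMeasurable (by fun_prop)
    · refine Eventually.of_forall fun y _ => ?_
      rw [hterm, norm_mul, Complex.norm_real, Real.norm_of_nonneg
        (mul_nonneg (partitionCount_nonneg k) (by positivity)),
        ← Complex.ofReal_intCast, ← Complex.ofReal_mul, Complex.norm_exp_ofReal_mul_I, mul_one]
    · exact Eventually.of_forall fun y _ =>
        summable_partitionCount_mul_pow (Real.exp_pos _).le hr1
    · exact intervalIntegrable_const
    · refine Eventually.of_forall fun y _ => (hasSum_partitionCount ?_).mul_right _
      rwa [norm_exp_neg_add_mul_I]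
  refine hsum.unique ?_
  have hval (k : ℕ) : ∫ y in (-Real.pi)..Real.pi,
      (partitionCount k : ℂ) * Complex.exp (-x + y * Complex.I) ^ k *
        Complex.exp (-(n * y : ℝ) * Complex.I) =
      if k = n then ((2 * Real.pi * partitionCount n * Real.exp (-(n * x)) : ℝ) : ℂ) else 0 := by
    simp_rw [hterm]
    rw [intervalIntegral.integral_const_mul, integral_exp_int_mul_I]
    rcases eq_or_ne k n with rfl | h
    · rw [if_pos (sub_self _), if_pos rfl, ← Real.exp_nat_mul]
      push_cast
      ring_nf
    · rw [if_neg (by omega), if_neg h, mul_zero]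
  simp_rw [hval]
  exact hasSum_ite_eq n _

/-- The radius `e^(-x)` of the circle of integration for the `n`-th coefficient: this `x` is the
saddle point, the minimum of `n x + π² / (6 x)`. (For `n = 0` it is zero by convention.) -/
noncomputable def saddlePoint (n : ℕ) : ℝ := Real.pi / √(6 * n)

theorem saddlePoint_pos {n : ℕ} (hn : 1 ≤ n) : 0 < saddlePoint n := by
  have := Real.pi_pos
  have : (0 : ℝ) < n := by exact_mod_cast hn
  unfold saddlePoint
  positivity

theorem pi_sq_div_saddlePoint_sq {n : ℕ} (hn : 1 ≤ n) :
    Real.pi ^ 2 / (6 * saddlePoint n ^ 2) = n := by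
  have hn' : (0 : ℝ) < n := by exact_mod_cast hn
  have := Real.pi_pos
  rw [saddlePoint, div_pow, Real.sq_sqrt (by positivity)]
  field_simp

theorem tendsto_saddlePoint :
    Tendsto saddlePoint atTop (nhdsWithin 0 (Set.Ioi 0)) := by
  refine tendsto_nhdsWithin_iff.mpr ⟨?_, (eventually_ge_atTop 1).mono fun n hn =>
    saddlePoint_pos hn⟩
  refine Tendsto.const_div_atTop ?_ _
  exact Real.tendsto_sqrt_atTop.comp
    (tendsto_natCast_atTop_atTop.const_mul_atTop (by norm_num))

/-- The integrand of Cauchy's formula on the circle through the saddle point, in the variable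
`v = x^(-3/2) y` and normalized by the order of magnitude at `y = 0`. -/
noncomputable def scaledIntegrand (n : ℕ) (v : ℝ) : ℂ :=
  (eulerProd (Complex.exp (-saddlePoint n +
      (saddlePoint n * √(saddlePoint n) * v : ℝ) * Complex.I)))⁻¹ *
    Complex.exp (-(n * (saddlePoint n * √(saddlePoint n) * v) : ℝ) * Complex.I) /
      realScale (saddlePoint n)

theorem integral_scaledIntegrand {n : ℕ} (hn : 1 ≤ n) :
    ∫ v in (-(Real.pi / (saddlePoint n * √(saddlePoint n))))..
        (Real.pi / (saddlePoint n * √(saddlePoint n))), scaledIntegrand n v =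
      (2 * Real.pi * partitionCount n * Real.exp (-(n * saddlePoint n)) /
        (saddlePoint n * √(saddlePoint n) * realScale (saddlePoint n)) : ℝ) := by
  have hx := saddlePoint_pos hn
  set x := saddlePoint n with hxdef
  have hδ : 0 < x * √x := mul_pos hx (Real.sqrt_pos.mpr hx)
  have h := intervalIntegral.integral_comp_mul_left (a := -(Real.pi / (x * √x)))
    (b := Real.pi / (x * √x))
    (fun y : ℝ => (eulerProd (Complex.exp (-x + y * Complex.I)))⁻¹ *
      Complex.exp (-(n * y : ℝ) * Complex.I)) hδ.ne'
  rw [mul_neg, mul_div_cancel₀ _ hδ.ne', integral_circle_eq_partitionCount hx] at h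
  simp only [scaledIntegrand, ← hxdef]
  rw [intervalIntegral.integral_div, h, Complex.real_smul]
  push_cast
  rw [div_mul_eq_div_div, div_eq_mul_inv _ ((x : ℂ) * √x)]
  ring

/-- The integrands, extended by zero to the real line, converge dominatedly to the Gaussian
`e^(-π² v² / 6)`. -/
theorem tendsto_integral_scaledIntegrand :
    Tendsto (fun n : ℕ => ∫ v in (-(Real.pi / (saddlePoint n * √(saddlePoint n))))..
        (Real.pi / (saddlePoint n * √(saddlePoint n))), scaledIntegrand n v) atTop
      (nhds ((√(6 / Real.pi) : ℝ) : ℂ)) := by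
  have hgauss : ∫ v : ℝ, ((Real.exp (-(Real.pi ^ 2 / 6) * v ^ 2) : ℝ) : ℂ) =
      ((√(6 / Real.pi) : ℝ) : ℂ) := by
    rw [integral_complex_ofReal, integral_gaussian]
    have := Real.pi_pos
    congr 2
    field_simp
  have hδ : Tendsto (fun n => saddlePoint n * √(saddlePoint n)) atTop
      (nhdsWithin 0 (Set.Ioi 0)) := by
    have h0 : Tendsto saddlePoint atTop (nhds 0) := tendsto_saddlePoint.mono_right
      nhdsWithin_le_nhds
    refine tendsto_nhdsWithin_iff.mpr ⟨?_, (eventually_ge_atTop 1).mono fun n hn =>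
      mul_pos (saddlePoint_pos hn) (Real.sqrt_pos.mpr (saddlePoint_pos hn))⟩
    simpa using h0.mul h0.sqrt
  have hL : Tendsto (fun n => Real.pi / (saddlePoint n * √(saddlePoint n))) atTop atTop := by
    simp_rw [div_eq_mul_inv]
    exact (tendsto_inv_nhdsGT_zero.comp hδ).const_mul_atTop Real.pi_pos
  rw [← hgauss]
  have hset : ∀ᶠ n : ℕ in atTop,
      ∫ v, (Set.Ioc (-(Real.pi / (saddlePoint n * √(saddlePoint n))))
        (Real.pi / (saddlePoint n * √(saddlePoint n)))).indicator (scaledIntegrand n) v =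
      ∫ v in (-(Real.pi / (saddlePoint n * √(saddlePoint n))))..
        (Real.pi / (saddlePoint n * √(saddlePoint n))), scaledIntegrand n v := by
    filter_upwards [hL.eventually_ge_atTop 0] with n hn
    rw [MeasureTheory.integral_indicator measurableSet_Ioc,
      intervalIntegral.integral_of_le (by linarith)]
  refine Tendsto.congr' hset ?_
  refine MeasureTheory.tendsto_integral_filter_of_dominated_convergence
    (fun v => 2 * arcMajorant v) ?_ ?_ (integrable_arcMajorant.const_mul 2) ?_
  · filter_upwards [eventually_ge_atTop 1] with n hn
    refine MeasureTheory.AEStronglyMeasurable.indicator ?_ measurableSet_Ioc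
    refine Continuous.aestronglyMeasurable ?_
    unfold scaledIntegrand
    refine Continuous.div_const (Continuous.mul ?_ (by fun_prop)) _
    exact (continuous_inv_eulerProd_circle (saddlePoint_pos hn)).comp
      (f := fun v : ℝ => saddlePoint n * √(saddlePoint n) * v) (by fun_prop)
  · have hle1 : ∀ᶠ n in atTop, saddlePoint n ≤ 1 :=
      (tendsto_saddlePoint.mono_right nhdsWithin_le_nhds).eventually_le_const one_pos
    have hle2 : ∀ᶠ n in atTop, ‖(eulerProd (Real.exp (-saddlePoint n) : ℂ))⁻¹‖ /
        realScale (saddlePoint n) ≤ 2 :=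
      (tendsto_norm_inv_eulerProd_div_realScale.comp tendsto_saddlePoint).eventually_le_const
        one_lt_two
    filter_upwards [hle1, hle2, eventually_ge_atTop 1] with n h1 h2 hn
    refine Eventually.of_forall fun v => ?_
    have hx := saddlePoint_pos hn
    have hA : 0 ≤ arcMajorant v := by unfold arcMajorant; positivity
    by_cases hv : v ∈ Set.Ioc (-(Real.pi / (saddlePoint n * √(saddlePoint n))))
        (Real.pi / (saddlePoint n * √(saddlePoint n)))
    · rw [Set.indicator_of_mem hv]
      have hδ0 : 0 < saddlePoint n * √(saddlePoint n) := mul_pos hx (Real.sqrt_pos.mpr hx)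
      have hv' : |saddlePoint n * √(saddlePoint n) * v| ≤ Real.pi := by
        rw [abs_mul, abs_of_pos hδ0, mul_comm, ← le_div_iff₀ hδ0]
        exact abs_le.mpr ⟨hv.1.le, hv.2⟩
      have hq : ‖Complex.exp (-saddlePoint n +
          (saddlePoint n * √(saddlePoint n) * v : ℝ) * Complex.I)‖ < 1 := by
        rw [norm_exp_neg_add_mul_I, Real.exp_lt_one_iff]
        linarith
      have hb := norm_inv_eulerProd_le hq
      rw [norm_exp_neg_add_mul_I] at hb
      have hb2 := hb.trans (mul_le_mul_of_nonneg_left (exp_neg_gap_le_arcMajorant hx h1 hv')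
        (norm_nonneg _))
      have hs := realScale_pos hx
      rw [scaledIntegrand, norm_div, norm_mul, Complex.norm_real, Real.norm_of_nonneg hs.le,
        norm_exp_neg_ofReal_mul_I, mul_one]
      calc _ ≤ _ := div_le_div_of_nonneg_right hb2 hs.le
        _ = _ := mul_div_right_comm _ _ _
        _ ≤ _ := mul_le_mul_of_nonneg_right h2 hA
    · rw [Set.indicator_of_notMem hv, norm_zero]
      positivity
  · refine Eventually.of_forall fun v => ?_
    refine ((tendsto_inv_eulerProd_scaled v).comp tendsto_saddlePoint).congr' ?_
    filter_upwards [hL.eventually_gt_atTop |v|, eventually_ge_atTop 1] with n hv hn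
    have hmem : v ∈ Set.Ioc (-(Real.pi / (saddlePoint n * √(saddlePoint n))))
        (Real.pi / (saddlePoint n * √(saddlePoint n))) :=
      ⟨(abs_lt.mp hv).1, (abs_lt.mp hv).2.le⟩
    rw [Set.indicator_of_mem hmem, Function.comp_apply,
      pi_sq_div_saddlePoint_sq hn]
    rfl

/-- The Hardy–Ramanujan asymptotic formula `p(n) ∼ e^(π √(2n/3)) / (4 √3 n)`. -/
theorem partitionCount_isEquivalent :
    partitionCount ~[atTop] fun n : ℕ =>
      Real.exp (Real.pi * √(2 * (n : ℝ) / 3)) / (4 * √3 * (n : ℝ)) := by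
  have hpi := Real.pi_pos
  have hG : 0 < √(6 / Real.pi) := by positivity
  have hlim : Tendsto (fun n : ℕ => 2 * Real.pi * partitionCount n *
      Real.exp (-(n * saddlePoint n)) /
        (saddlePoint n * √(saddlePoint n) * realScale (saddlePoint n))) atTop
      (nhds √(6 / Real.pi)) := by
    refine ((Complex.continuous_re.tendsto _).comp tendsto_integral_scaledIntegrand).congr' ?_
    filter_upwards [eventually_ge_atTop 1] with n hn
    rw [Function.comp_apply, integral_scaledIntegrand hn, Complex.ofReal_re]
  have hne : ∀ᶠ n : ℕ in atTop,
      Real.exp (Real.pi * √(2 * (n : ℝ) / 3)) / (4 * √3 * (n : ℝ)) ≠ 0 := by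
    filter_upwards [eventually_ge_atTop 1] with n hn
    have : (0 : ℝ) < n := by exact_mod_cast hn
    positivity
  rw [isEquivalent_iff_tendsto_one hne]
  have h1 := hlim.div_const √(6 / Real.pi)
  rw [div_self hG.ne'] at h1
  refine h1.congr' ?_
  filter_upwards [eventually_ge_atTop 1] with n hn
  have hn' : (0 : ℝ) < n := by exact_mod_cast hn
  have hx := saddlePoint_pos hn
  have hxn := pi_sq_div_saddlePoint_sq hn
  have hexp : Real.exp (Real.pi * √(2 * (n : ℝ) / 3)) =
      Real.exp (n * saddlePoint n) * Real.exp (Real.pi ^ 2 / (6 * saddlePoint n)) := by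
    rw [← Real.exp_add]
    congr 1
    have h6 : √(6 * (n : ℝ)) ^ 2 = 6 * n := Real.sq_sqrt (by positivity)
    have h7 : √(2 * (n : ℝ) / 3) = √(6 * n) / 3 := by
      rw [show 2 * (n : ℝ) / 3 = 6 * n / 3 ^ 2 by ring, Real.sqrt_div (by positivity),
        Real.sqrt_sq (by norm_num)]
    have h8 : 0 < √(6 * (n : ℝ)) := by positivity
    rw [h7, saddlePoint]
    field_simp
    nlinarith
  set x := saddlePoint n
  -- The powers of `x` combine to `x² = π² / (6 n)`, the source of the factor `1 / (4 √3 n)`.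
  have hconst : x * √x * √(x / (2 * Real.pi)) * √(6 / Real.pi) * (4 * √3 * n) =
      2 * Real.pi := by
    have h1 : √x * √(x / (2 * Real.pi)) * √(6 / Real.pi) * √3 = 3 * x / Real.pi := by
      rw [← Real.sqrt_mul hx.le, ← Real.sqrt_mul (by positivity), ← Real.sqrt_mul (by positivity),
        show x * (x / (2 * Real.pi)) * (6 / Real.pi) * 3 = (3 * x / Real.pi) ^ 2 by
          field_simp; norm_num, Real.sqrt_sq (by positivity)]
    calc _ = x * (√x * √(x / (2 * Real.pi)) * √(6 / Real.pi) * √3) * 4 * n := by ring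
      _ = 2 * Real.pi := by
        rw [h1, ← hxn]
        field_simp
        norm_num
  rw [Pi.div_apply, hexp, realScale, Real.exp_neg]
  have hp1 : 0 < √x := Real.sqrt_pos.mpr hx
  have hp2 : 0 < √(x / (2 * Real.pi)) := by positivity
  have hp3 : 0 < √3 := by positivity
  rw [div_div, div_div_eq_mul_div, div_eq_div_iff (by positivity) (by positivity)]
  generalize √x = a at *
  generalize √(x / (2 * Real.pi)) = b at *
  generalize √(6 / Real.pi) = c at *
  generalize √3 = d at *
  rw [← hconst]
  field_simp

/-! ### The asymptotics of the restricted coloured partitions -/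

/-- The right-hand side of the Hardy–Ramanujan formula. -/
noncomputable def hardyRamanujan (n : ℕ) : ℝ :=
  Real.exp (Real.pi * √(2 * (n : ℝ) / 3)) / (4 * √3 * (n : ℝ))

theorem tendsto_sqrt_succ_sub_sqrt :
    Tendsto (fun n : ℕ => √(2 * ((n + 1 : ℕ) : ℝ) / 3) - √(2 * (n : ℝ) / 3)) atTop (nhds 0) := by
  have hlim : Tendsto (fun n : ℕ => (√(2 * (n : ℝ) / 3))⁻¹) atTop (nhds 0) := by
    refine tendsto_inv_atTop_zero.comp (Real.tendsto_sqrt_atTop.comp ?_)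
    exact (tendsto_natCast_atTop_atTop.const_mul_atTop two_pos).atTop_div_const three_pos
  refine tendsto_of_tendsto_of_tendsto_of_le_of_le' tendsto_const_nhds hlim
    (Eventually.of_forall fun n => ?_) ?_
  · refine sub_nonneg.mpr (Real.sqrt_le_sqrt ?_)
    push_cast
    linarith
  · filter_upwards [eventually_ge_atTop 1] with n hn
    have hn' : (0 : ℝ) < n := by exact_mod_cast hn
    have hs : 0 < √(2 * (n : ℝ) / 3) := by positivity
    have hsq := Real.sq_sqrt (by positivity : 0 ≤ 2 * (n : ℝ) / 3)
    have hle : √(2 * ((n + 1 : ℕ) : ℝ) / 3) ≤ √(2 * (n : ℝ) / 3) + (√(2 * (n : ℝ) / 3))⁻¹ := by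
      refine Real.sqrt_le_iff.mpr ⟨by positivity, ?_⟩
      rw [add_sq, hsq, mul_assoc, mul_inv_cancel₀ hs.ne']
      have := sq_nonneg (√(2 * (n : ℝ) / 3))⁻¹
      push_cast
      linarith
    linarith

theorem hardyRamanujan_succ_isEquivalent :
    (fun n => hardyRamanujan (n + 1)) ~[atTop] hardyRamanujan := by
  have hne : ∀ᶠ n : ℕ in atTop, hardyRamanujan n ≠ 0 := by
    filter_upwards [eventually_ge_atTop 1] with n hn
    have : (0 : ℝ) < n := by exact_mod_cast hn
    unfold hardyRamanujan
    positivity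
  rw [isEquivalent_iff_tendsto_one hne]
  have h1 : Tendsto (fun n : ℕ => Real.exp (Real.pi *
      (√(2 * ((n + 1 : ℕ) : ℝ) / 3) - √(2 * (n : ℝ) / 3)))) atTop (nhds 1) := by
    have := (Real.continuous_exp.tendsto _).comp (tendsto_sqrt_succ_sub_sqrt.const_mul Real.pi)
    rwa [mul_zero, Real.exp_zero] at this
  have h2 := h1.mul (tendsto_natCast_div_add_atTop (1 : ℝ))
  rw [mul_one] at h2
  refine h2.congr' ?_
  filter_upwards [eventually_ge_atTop 1] with n hn
  have : (0 : ℝ) < n := by exact_mod_cast hn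
  rw [Pi.div_apply, hardyRamanujan, hardyRamanujan, mul_sub, Real.exp_sub]
  push_cast
  have h3 : √(3 : ℝ) ≠ 0 := by positivity
  generalize √(3 : ℝ) = d at *
  field_simp

theorem corollary1p5 :
    akG ~[atTop] fun n : ℕ =>
      Real.exp (Real.pi * Real.sqrt (2 * (n : ℝ) / 3)) / (4 * Real.sqrt 3 * (n : ℝ)) := by
  change akG ~[atTop] hardyRamanujan
  have hp0 : partitionCount ~[atTop] hardyRamanujan := partitionCount_isEquivalent
  have hp1 : (fun n => partitionCount (n + 1)) ~[atTop] hardyRamanujan :=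
    (hp0.comp_tendsto (tendsto_add_atTop_nat 1)).trans hardyRamanujan_succ_isEquivalent
  have hp2 : (fun n => partitionCount (n + 2)) ~[atTop] hardyRamanujan :=
    (hp1.comp_tendsto (tendsto_add_atTop_nat 1)).trans hardyRamanujan_succ_isEquivalent
  have hdiff : (fun n => partitionCount (n + 2) - partitionCount (n + 1)) =o[atTop]
      hardyRamanujan := by
    simpa using hp2.isLittleO.sub hp1.isLittleO
  have hg : (fun n => akG (n + 1)) ~[atTop] hardyRamanujan := by
    have herr : (fun n => akG (n + 1) - partitionCount n) =o[atTop] hardyRamanujan := by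
      refine (IsBigO.of_norm_le fun n => ?_).trans_isLittleO hdiff
      rw [Real.norm_of_nonneg (sub_nonneg.mpr (partitionCount_le_akG_succ n))]
      exact sub_le_iff_le_add'.mpr (akG_succ_le n)
    refine (hp0.add_isLittleO herr).congr_left (Eventually.of_forall fun n => ?_)
    exact add_sub_cancel _ _
  have hg' : (fun n => akG (n + 1)) ~[atTop] fun n => hardyRamanujan (n + 1) :=
    hg.trans hardyRamanujan_succ_isEquivalent.symm
  have hshift := hg'.comp_tendsto (tendsto_sub_atTop_nat 1)
  refine (hshift.congr_left ?_).congr_right ?_ <;>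
  · filter_upwards [eventually_ge_atTop 1] with n hn
    simp only [Function.comp_apply, Nat.sub_add_cancel hn]
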